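/- **Setting.** All distributions are discrete. A *nonlocal game* has a finite set $P$ of players. The verifier draws a question $\mathcal Q$ from a fixed discrete distribution, where a question consists of inputs to all or some of the players; the players addressed respond without communicating, and a predicate (depending on $\mathcal Q$) of their responses decides acceptance. "Question" below means a question of positive probability. The predicate for $\mathcal Q$ *depends on* a player if changing only that player's response can change the verdict. The game is *unique* if for every question and every player $v$ on whose response the predicate depends, for any fixed responses of the other addressed players exactly one response of $v$ is accepted. A *multi-round non-signaling resource* is a conditional probability distribution $\Pr[(\vec X^{(p)})_{p}\mid(\vec A^{(p)})_{p}]$ on output vectors given input vectors (of a finite length for each player $p$; the players with positive length are those *involved*) such that for all $(j_p)_p$ the joint law of the first $j_p$ outputs of every player $p$ depends only on the first $j_p$ inputs of every player $p$. In a *strategy*, the players share finitely many independent such resources and a random variable independent of them; depending on this variable and on his input, each addressed player adaptively queries his ends of the resources, in any order and at most once per round, and then responds. **Lemma.** Consider a unique nonlocal game, and let $\mathcal S$ be a strategy that wins with probability at least $1-\epsilon$ on every question. Fix a player $v$ and one of the resources $R$ used by $\mathcal S$, with $v$ involved in $R$. Let $\mathcal Q$ be a question whose predicate depends on $v$'s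 response, and let $U$ be the set of the players other than $v$ on whose responses the predicate for $\mathcal Q$ depends. Assume that no player of $U$ is involved in $R$. Assume further that for every other question $\mathcal Q'$ in which $v$'s input is the same as in $\mathcal Q$, and for every $u\in U$, either $u$'s input in $\mathcal Q'$ is the same as in $\mathcal Q$ or the predicate for $\mathcal Q'$ does not depend on $u$'s response. Then there is a strategy $\mathcal S'$, with the same resources and randomness, that is the same as $\mathcal S$ except for $v$'s behavior on its input in $\mathcal Q$, in which $v$ never queries $R$ on this input, and that wins with probability at least $1-3\epsilon$ on every question. Moreover $$\Pr[\mathcal S'\text{ loses}\mid\mathcal Q]\le\Pr[\mathcal S\text{ loses}\mid\mathcal Q],$$ $$\Pr[\mathcal S'\text{ loses}\mid\mathcal Q']\le\Pr[\mathcal S\text{ loses}\mid\mathcal Q']+2\Pr[\mathcal S\text{ loses}\mid\mathcal Q]$$ for every question $\mathcal Q'$ in which $v$'s input is the same as in $\mathcal Q$. -/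

import Mathlib

open scoped ENNReal

/-- A multi-round non-signaling resource shared by the players in `P`.  Player `p` may query it
`rounds p` times, with inputs in `In p` and outputs in `Out p`; the resource is the conditional
law `law a` of all the outputs given all the inputs `a`. -/
structure NonSignalingResource (P : Type*) where
  /-- number of rounds of each player (zero for a player who is not a party of the resource) -/
  rounds : P → ℕ
  /-- input alphabets -/
  In : P → Type*
  /-- output alphabets -/
  Out : P → Type*
  nonempty_in : ∀ p, Nonempty (In p)
  /-- conditional distribution of the output vectors given the input vectors -/
  law : (∀ p, Fin (rounds p) → In p) → PMF (∀ p, Fin (rounds p) → Out p)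
  /-- For all `j`, the joint law of the first `j p` outputs of every player `p` depends only on
  the first `j p` inputs of every player `p`. -/
  nonsignaling : ∀ (j : P → ℕ) (a a' : ∀ p, Fin (rounds p) → In p),
    (∀ p (r : Fin (rounds p)), r.1 < j p → a p r = a' p r) →
      (law a).map (fun x p (r : {r : Fin (rounds p) // r.1 < j p}) => x p r.1) =
        (law a').map (fun x p (r : {r : Fin (rounds p) // r.1 < j p}) => x p r.1)

/-- Player `p` is a party of the resource. -/
def NonSignalingResource.Involves {P : Type*} (R : NonSignalingResource P) (p : P) : Prop :=
  0 < R.rounds p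

/-- The behaviour of one player on one input: an adaptive sequence of queries to resources
`i : ι`, followed by a response in `Y`.  Resource `i` has input alphabet `A i`, output alphabet
`X i` and `m i` rounds for this player; the index `c` counts the queries made so far. -/
inductive ResourceProgram {ι : Type*} [DecidableEq ι] (A X : ι → Type*) (m : ι → ℕ) (Y : Type*) :
    (ι → ℕ) → Type _
  | answer {c : ι → ℕ} (y : Y) : ResourceProgram A X m Y c
  | query {c : ι → ℕ} (i : ι) (h : c i < m i) (a : A i)
      (k : X i → ResourceProgram A X m Y (Function.update c i (c i + 1))) :
      ResourceProgram A X m Y c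

namespace ResourceProgram

variable {ι : Type*} [DecidableEq ι] {A X : ι → Type*} {m : ι → ℕ} {Y : Type*}

/-- The response, when the `r`-th output that resource `i` gives to the player is `x i r`. -/
def response : {c : ι → ℕ} → ResourceProgram A X m Y c → (∀ i, Fin (m i) → X i) → Y
  | _, answer y, _ => y
  | c, query i h _ k, x => (k (x i ⟨c i, h⟩)).response x

/-- The inputs given to the resources, when the `r`-th output that resource `i` gives to the
player is `x i r`; rounds that are not used are filled with the inputs `d`. -/
def inputs (d : ∀ i, Fin (m i) → A i) :
    {c : ι → ℕ} → ResourceProgram A X m Y c → (∀ i, Fin (m i) → X i) → ∀ i, Fin (m i) → A i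
  | _, answer _, _ => d
  | c, query i h a k, x =>
    let b := (k (x i ⟨c i, h⟩)).inputs d x
    Function.update b i (Function.update (b i) ⟨c i, h⟩ a)

/-- The program never queries resource `R`. -/
def Ignores (R : ι) : {c : ι → ℕ} → ResourceProgram A X m Y c → Prop
  | _, answer _ => True
  | _, query i _ _ k => i ≠ R ∧ ∀ y, (k y).Ignores R

end ResourceProgram

/-- A nonlocal game.  A question sends inputs to all or some of the players (`none` means that
the player is not addressed); the addressed players respond. -/
structure NonlocalGame (P : Type*) where
  /-- inputs to the players -/
  In : P → Type*
  /-- responses of the players -/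
  Out : P → Type*
  /-- the distribution from which the verifier draws the question -/
  prior : PMF (∀ p, Option (In p))
  /-- the acceptance predicate, applied to the responses of the addressed players -/
  accept : (q : ∀ p, Option (In p)) → (∀ p : {p // (q p).isSome}, Out p) → Prop

namespace NonlocalGame

variable {P : Type*} (G : NonlocalGame P)

/-- All tuples of inputs to all or some of the players. -/
abbrev Question : Type _ := ∀ p, Option (G.In p)

/-- The responses of the players who are addressed in question `q`. -/
abbrev Responses (q : G.Question) : Type _ := ∀ p : {p // (q p).isSome}, G.Out p

/-- The questions of the game: those that are asked with positive probability. -/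
def questions : Set G.Question := G.prior.support

/-- The acceptance predicate for question `q` depends on the response of player `p`. -/
def DependsOn (q : G.Question) (p : P) : Prop :=
  ∃ r r' : G.Responses q, (∀ u, u.1 ≠ p → r u = r' u) ∧ G.accept q r ∧ ¬ G.accept q r'

/-- The game is unique: for any question and any player `v` on whose response acceptance
depends, given the other responses exactly one response of `v` is accepted. -/
def IsUnique [DecidableEq P] : Prop :=
  ∀ q ∈ G.questions, ∀ v : {p // (q p).isSome}, G.DependsOn q v →
    ∀ r : G.Responses q, ∃! y : G.Out v, G.accept q (Function.update r v y)

variable {ι : Type*} [DecidableEq ι] (ρ : ι → NonSignalingResource P)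

/-- A strategy of classical players with resources `ρ` and randomness in `Λ`: for each value of
the randomness, each player and each input of that player, the player's behaviour. -/
abbrev Strategy (Λ : Type*) : Type _ :=
  Λ → ∀ p : P, G.In p → ResourceProgram (fun i => (ρ i).In p) (fun i => (ρ i).Out p)
    (fun i => (ρ i).rounds p) (G.Out p) 0

variable {G ρ} {Λ : Type*}

/-- All the outputs of all the resources. -/
abbrev Outputs (ρ : ι → NonSignalingResource P) : Type _ :=
  ∀ i p, Fin ((ρ i).rounds p) → (ρ i).Out p

/-- The inputs given to the resources on question `q`, if their outputs are `x`.  Rounds that are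
not used are filled with arbitrary inputs; as the resources are non-signaling, the choice of these
does not affect the law of the outputs that are used. -/
noncomputable def resourceInputs (S : G.Strategy ρ Λ) (l : Λ) (q : G.Question) (x : Outputs ρ)
    (i : ι) (p : P) : Fin ((ρ i).rounds p) → (ρ i).In p :=
  match q p with
  | none => fun _ => Classical.choice ((ρ i).nonempty_in p)
  | some z => (S l p z).inputs (fun i _ => Classical.choice ((ρ i).nonempty_in p))
      (fun i => x i p) i

/-- The responses on question `q`, if the outputs of the resources are `x`. -/
def responses (S : G.Strategy ρ Λ) (l : Λ) (q : G.Question) (x : Outputs ρ) : G.Responses q :=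
  fun p => (S l p.1 ((q p.1).get p.2)).response (fun i => x i p.1)

/-- The probability that the responses to question `q` lie in `E`, for a strategy `S` with
randomness of law `μ`: the sum of the probabilities of the outputs `x` that lead to `E`, where
the resources are independent and `x` has probability `∏ i, Pr_i[x_i | inputs along x]`. -/
noncomputable def prob [Fintype ι] (μ : PMF Λ) (S : G.Strategy ρ Λ) (q : G.Question)
    (E : Set (G.Responses q)) : ℝ≥0∞ :=
  ∑' (l : Λ) (x : Outputs ρ),
    μ l * (∏ i, (ρ i).law (resourceInputs S l q x i) (x i)) *
      E.indicator 1 (responses S l q x)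

/-- The probability that the strategy wins on question `q`. -/
noncomputable def winProb [Fintype ι] (μ : PMF Λ) (S : G.Strategy ρ Λ) (q : G.Question) : ℝ :=
  (prob μ S q {r | G.accept q r}).toReal

/-- The probability that the strategy loses on question `q`. -/
noncomputable def loseProb [Fintype ι] (μ : PMF Λ) (S : G.Strategy ρ Λ) (q : G.Question) : ℝ :=
  (prob μ S q {r | ¬ G.accept q r}).toReal

end NonlocalGame

/-! Fix the shared randomness. On `Q`, acceptance depends only on `v` and on players who are no
parties of `R`. Non-signaling lets all other players be silenced without changing the loss, and then
`R` is to `v` merely a source of local randomness: given `v`'s inputs to it, its outputs are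
independent of everything else that matters. Walking down `v`'s program, each query to `R` can
therefore be replaced by a fixed output that does at least as well as the average. The result
ignores `R` and loses on `Q` no more often than before (`exists_ignores_prefixSum_le`,
`exists_ignores_loseAt_le`).

For another question `q` with the same input of `v`, uniqueness on `Q` singles out the one correct
response `c` of `v`, a function of the responses of `U`. By the compatibility hypothesis there is
one tuple of inputs on which the players relevant for `q` and those relevant for `Q` all behave as
in their own question, so both verdicts live on one probability space. There `v` answers `c` except
when `Q` is lost. Replacing `v`'s response by `c` gives a quantity that does not see `v`'s behavior;
it differs from the loss on `q` by at most the loss on `Q`, for the old and for the new strategy.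
This costs one loss of each on `Q`, hence the factor 2 (`loseAt_le_add`).

Both halves rest on `prefixSum_eq_prod_marginal` and its consequence `tsum_weight_congr`: even for
adaptive interleaved queries, what a set of players sees is not affected by the queries of the
others. -/

/-! ### Sums over product spaces, and the non-signaling condition in summed form -/

/-- Weighted sums against the image of a discrete distribution. -/
lemma PMF.tsum_map_mul {α β : Type*} (p : PMF α) (g : α → β) (f : β → ℝ≥0∞) :
    ∑' b, p.map g b * f b = ∑' a, p a * f (g a) := by
  classical
  simp only [PMF.map_apply, ← ENNReal.tsum_mul_right]
  rw [ENNReal.tsum_comm]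
  refine tsum_congr fun a => ?_
  rw [tsum_eq_single (g a) (by intro b hb; simp [hb])]
  simp

/-- Summing a product of functions of the separate coordinates. -/
lemma ENNReal.tsum_pi_prod {ι : Type*} [Fintype ι] {α : ι → Type*} (f : ∀ i, α i → ℝ≥0∞) :
    ∑' x : ∀ i, α i, ∏ i, f i (x i) = ∏ i, ∑' y, f i y := by
  classical
  refine Fintype.induction_empty_option (P := fun ι _ => ∀ (α : ι → Type _) (f : ∀ i, α i → ℝ≥0∞),
    ∑' x : ∀ i, α i, ∏ i, f i (x i) = ∏ i, ∑' y, f i y) ?_ ?_ ?_ ι α f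
  · intro β γ _ e ih α f
    let := Fintype.ofEquiv _ e.symm
    rw [← (Equiv.piCongrLeft α e).tsum_eq, ← e.prod_comp, ← ih _ (fun i => f (e i))]
    refine tsum_congr fun x => ?_
    rw [← e.prod_comp]
    simp
  · intro α f
    simp
  · intro β _ ih α f
    rw [Fintype.prod_option, ← ih _ (fun i => f (some i)),
      ← (Equiv.piOptionEquivProd (β := α)).symm.tsum_eq]
    refine (ENNReal.tsum_prod (f := fun a b => ∏ i, f i
      ((Equiv.piOptionEquivProd (β := α)).symm (a, b) i))).trans ?_
    simp [Fintype.prod_option, Equiv.piOptionEquivProd, ENNReal.tsum_mul_left,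
      ENNReal.tsum_mul_right]

/-- A sum over a product space, with one coordinate summed first. -/
lemma ENNReal.tsum_pi_update {ι : Type*} [DecidableEq ι] {α : ι → Type*} (i : ι) (y : α i)
    (f : (∀ i, α i) → ℝ≥0∞) :
    ∑' x, f x = ∑' x : ∀ i, α i, {x : ∀ i, α i | x i = y}.indicator
      (fun x => ∑' w, f (Function.update x i w)) x := by
  classical
  -- Every `x` is charged to the representative of its fibre whose coordinate `i` equals `y`.
  have key : ∀ x : ∀ i, α i, f x = ∑' x' : ∀ i, α i,
      if x' = Function.update x i y then f x else 0 := fun x => by simp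
  rw [tsum_congr key, ENNReal.tsum_comm]
  refine tsum_congr fun x' => ?_
  by_cases h : x' i = y
  · rw [Set.indicator_of_mem (by exact h)]
    have hinj : Function.Injective (fun w : α i => Function.update x' i w) :=
      Function.update_injective x' i
    rw [← hinj.tsum_eq]
    · refine tsum_congr fun w => ?_
      rw [if_pos]
      subst h
      simp
    · intro x hx
      have : x' = Function.update x i y := by
        by_contra hne
        simp [hne] at hx
      exact ⟨x i, by simp [this]⟩
  · rw [Set.indicator_of_notMem (by exact h)]
    refine ENNReal.tsum_eq_zero.2 fun x => if_neg ?_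
    rintro rfl
    simp at h

/-- A sum over a product space of a function that splits off a factor depending on one
coordinate. -/
lemma ENNReal.tsum_pi_eq_mul {ι : Type*} [DecidableEq ι] {α : ι → Type*} (i : ι) (y : α i)
    (f K : (∀ i, α i) → ℝ≥0∞) (q : α i → ℝ≥0∞)
    (h : ∀ x w, x i = y → f (Function.update x i w) = K x * q w) :
    ∑' x, f x = (∑' x, {x : ∀ i, α i | x i = y}.indicator K x) * ∑' w, q w := by
  classical
  rw [ENNReal.tsum_pi_update i y f, ← ENNReal.tsum_mul_right]
  refine tsum_congr fun x => ?_
  simp only [Set.indicator_apply, Set.mem_ofPred_eq]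
  by_cases hx : x i = y
  · rw [if_pos hx, if_pos hx, ← ENNReal.tsum_mul_left]
    exact tsum_congr fun w => h x w hx
  · rw [if_neg hx, if_neg hx, zero_mul]

/-- Some value is at most the average. -/
lemma ENNReal.exists_mul_tsum_le {α : Type*} [Nonempty α] (p f : α → ℝ≥0∞)
    (hp : ∑' a, p a ≠ ∞) : ∃ a, f a * ∑' a, p a ≤ ∑' a, f a * p a := by
  by_contra! hcon
  have hne : ∑' a, f a * p a ≠ ∞ := (hcon (Classical.arbitrary α)).ne_top
  have hpos : ∑' a, p a ≠ 0 := by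
    intro h0
    have := hcon (Classical.arbitrary α)
    simp [h0] at this
  obtain ⟨a, ha⟩ : ∃ a, p a ≠ 0 := by
    by_contra! h
    exact hpos (ENNReal.tsum_eq_zero.2 h)
  set s := ∑' a, p a with hs
  set F := ∑' a, f a * p a with hF
  have hlt : ∀ a, F / s < f a := fun a => ENNReal.div_lt_of_lt_mul (hcon a)
  have hFs : F / s ≠ ∞ := (hlt a).ne_top
  have htot : ∑' a, F / s * p a = F := by
    rw [ENNReal.tsum_mul_left, ← hs, ENNReal.div_mul_cancel hpos hp]
  have : ∑' a, F / s * p a < ∑' a, f a * p a :=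
    ENNReal.tsum_lt_tsum (i := a) (by rw [htot]; exact hne)
      (fun b => by gcongr; exact (hlt b).le)
      (ENNReal.mul_lt_mul_left ha (fun h => hp (ENNReal.tsum_eq_top_of_eq_top ⟨a, h⟩)) (hlt a))
  rw [htot] at this
  exact this.ne rfl

/-- A marginal of a non-signaling resource depends only on the inputs that precede it. -/
lemma NonSignalingResource.tsum_law_congr {P : Type*} [DecidableEq P] (R : NonSignalingResource P)
    (v : P) (n : ℕ) {a a' : ∀ p, Fin (R.rounds p) → R.In p} (ha : ∀ p, p ≠ v → a p = a' p)
    (hv : ∀ r : Fin (R.rounds v), r.1 < n → a v r = a' v r)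
    (f : (∀ p, Fin (R.rounds p) → R.Out p) → ℝ≥0∞)
    (hf : ∀ x x', (∀ p, p ≠ v → x p = x' p) → (∀ r : Fin (R.rounds v), r.1 < n → x v r = x' v r) →
      f x = f x') :
    ∑' x, R.law a x * f x = ∑' x, R.law a' x * f x := by
  -- Only the rounds of `v` from `n` on are traced out; the other players keep all their rounds.
  set j : P → ℕ := fun p => if p = v then n else R.rounds p with hj
  have hfac : Function.FactorsThrough f
      (fun (x : ∀ p, Fin (R.rounds p) → R.Out p) p (r : {r : Fin (R.rounds p) // r.1 < j p}) =>
        x p r.1) := by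
    intro x x' h
    refine hf x x' (fun p hp => funext fun r => ?_) (fun r hr => ?_)
    · exact congrFun (congrFun h p) ⟨r, by simp [hj, hp]⟩
    · exact congrFun (congrFun h v) ⟨r, by simpa [hj] using hr⟩
  obtain ⟨e, rfl⟩ := (Function.factorsThrough_iff _).1 hfac
  have := R.nonsignaling j a a' (fun p r hr => by
    by_cases hp : p = v
    · subst hp; exact hv r (by simpa [hj] using hr)
    · rw [ha p hp])
  simp only [Function.comp]
  rw [← PMF.tsum_map_mul, this, PMF.tsum_map_mul]
-- Adaptive programs and sums over their transcripts
namespace ResourceProgram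

variable {ι : Type*} [DecidableEq ι] {A X : ι → Type*} {m : ι → ℕ} {Y : Type*}

/-- The table `d`, with the entry of round `r` of resource `i` replaced by `a`. -/
def setRound {B : ι → Type*} (d : ∀ i, Fin (m i) → B i) (i : ι) (r : Fin (m i)) (a : B i) :
    ∀ i, Fin (m i) → B i :=
  Function.update d i (Function.update (d i) r a)

lemma setRound_self {B : ι → Type*} (d : ∀ i, Fin (m i) → B i) (i : ι) (r : Fin (m i)) (a : B i) :
    setRound d i r a i = Function.update (d i) r a := by
  simp [setRound]

lemma setRound_of_ne {B : ι → Type*} (d : ∀ i, Fin (m i) → B i) {i j : ι} (h : j ≠ i)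
    (r : Fin (m i)) (a : B i) : setRound d i r a j = d j := by
  simp [setRound, h]

lemma setRound_comm {B : ι → Type*} (d : ∀ i, Fin (m i) → B i) {i j : ι} {r : Fin (m i)}
    {s : Fin (m j)} (h : i = j → r.1 ≠ s.1) (a : B i) (b : B j) :
    setRound (setRound d i r a) j s b = setRound (setRound d j s b) i r a := by
  unfold setRound
  by_cases hij : i = j
  · subst hij
    have : r ≠ s := fun e => h rfl (congrArg _ e)
    simp [Function.update_comm this]
  · rw [Function.update_comm hij, Function.update_of_ne (Ne.symm hij), Function.update_of_ne hij]

lemma inputs_congr {c : ι → ℕ} (t : ResourceProgram A X m Y c) {d d' : ∀ i, Fin (m i) → A i}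
    (x : ∀ i, Fin (m i) → X i) {j : ι} (h : d j = d' j) :
    t.inputs d x j = t.inputs d' x j := by
  induction t with
  | answer y => exact h
  | query i hi a k ih =>
    by_cases hj : j = i
    · subst hj
      simp [inputs, ih]
    · simp [inputs, hj, ih]

lemma inputs_setRound {c : ι → ℕ} (t : ResourceProgram A X m Y c) (d : ∀ i, Fin (m i) → A i)
    (x : ∀ i, Fin (m i) → X i) (j : ι) (r : Fin (m j)) (hr : r.1 < c j) (b : A j) :
    t.inputs (setRound d j r b) x = setRound (t.inputs d x) j r b := by
  induction t with
  | answer y => rfl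
  | @query c i hi a k ih =>
    have hr' : r.1 < Function.update c i (c i + 1) j := by
      by_cases hj : j = i
      · subst hj; simp; omega
      · simpa [hj] using hr
    change setRound ((k _).inputs _ x) i _ a = setRound (setRound ((k _).inputs d x) i _ a) j r b
    rw [ih _ hr', setRound_comm]
    rintro rfl
    simp
    omega

/-- Later queries never return to a used round, so an input may be recorded in the default table
before the continuation runs. This forward form is what inductions along a program need. -/
lemma inputs_query {c : ι → ℕ} (i : ι) (hi : c i < m i) (a : A i)
    (k : X i → ResourceProgram A X m Y (Function.update c i (c i + 1)))
    (d : ∀ i, Fin (m i) → A i) (x : ∀ i, Fin (m i) → X i) :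
    (query i hi a k).inputs d x =
      (k (x i ⟨c i, hi⟩)).inputs (setRound d i ⟨c i, hi⟩ a) x := by
  rw [inputs_setRound _ _ _ _ _ (by simp)]
  rfl

lemma Ignores.inputs_eq {R : ι} {c : ι → ℕ} {t : ResourceProgram A X m Y c} (ht : t.Ignores R)
    (d : ∀ i, Fin (m i) → A i) (x : ∀ i, Fin (m i) → X i) : t.inputs d x R = d R := by
  induction t with
  | answer y => rfl
  | query i hi a k ih =>
    have := ht.1
    simp [inputs, this.symm, ih _ (ht.2 _)]

/-- The queries of a program, without its response. -/
def forget : {c : ι → ℕ} → ResourceProgram A X m Y c → ResourceProgram A X m Unit c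
  | _, answer _ => answer ()
  | _, query i h a k => query i h a fun y => (k y).forget

lemma inputs_forget {c : ι → ℕ} (t : ResourceProgram A X m Y c) (d : ∀ i, Fin (m i) → A i)
    (x : ∀ i, Fin (m i) → X i) : t.forget.inputs d x = t.inputs d x := by
  induction t with
  | answer y => rfl
  | query i hi a k ih => simp [forget, inputs, ih]

/-- The tables `x` and `h` agree in the first `c i` rounds of each resource `i`. -/
def Agree (c : ι → ℕ) (x h : ∀ i, Fin (m i) → X i) : Prop :=
  ∀ i (r : Fin (m i)), r.1 < c i → x i r = h i r

lemma update_eq_iff_of_lt_succ {B : Type*} {n k : ℕ} (hk : k < n) (x h : Fin n → B) (y : B) :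
    (∀ r : Fin n, r.1 < k + 1 → x r = Function.update h ⟨k, hk⟩ y r) ↔
      (∀ r : Fin n, r.1 < k → x r = h r) ∧ x ⟨k, hk⟩ = y := by
  constructor
  · refine fun H => ⟨fun r hr => ?_, by simpa using H ⟨k, hk⟩ (by simp)⟩
    rw [H r (by omega), Function.update_of_ne]
    rintro rfl
    simp at hr
  · rintro ⟨H, rfl⟩ r hr
    by_cases hrk : r = ⟨k, hk⟩
    · subst hrk; simp
    · rw [Function.update_of_ne hrk]
      refine H r ?_
      have : r.1 ≠ k := fun e => hrk (Fin.ext e)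
      omega

lemma agree_setRound_iff {c : ι → ℕ} {i : ι} (hi : c i < m i) (x h : ∀ i, Fin (m i) → X i)
    (y : X i) :
    Agree (Function.update c i (c i + 1)) x (setRound h i ⟨c i, hi⟩ y) ↔
      Agree c x h ∧ x i ⟨c i, hi⟩ = y := by
  have split : ∀ (e : ι → ℕ) (g : ∀ i, Fin (m i) → X i), Agree e x g ↔
      (∀ r : Fin (m i), r.1 < e i → x i r = g i r) ∧
        ∀ j, j ≠ i → ∀ r : Fin (m j), r.1 < e j → x j r = g j r := by
    refine fun e g => ⟨fun H => ⟨H i, fun j _ => H j⟩, fun H j => ?_⟩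
    by_cases hj : j = i
    · subst hj; exact H.1
    · exact H.2 j hj
  rw [split, split, Function.update_self, setRound_self, update_eq_iff_of_lt_succ hi]
  have : (∀ j, j ≠ i → ∀ r : Fin (m j), r.1 < Function.update c i (c i + 1) j →
      x j r = setRound h i ⟨c i, hi⟩ y j r) ↔
      ∀ j, j ≠ i → ∀ r : Fin (m j), r.1 < c j → x j r = h j r := by
    refine forall_congr' fun j => forall_congr' fun hj => ?_
    rw [Function.update_of_ne hj, setRound_of_ne _ hj]
  rw [this]
  tauto

/-- Sum of a function `Φ` of an outcome, of the inputs given to the resources and of the response,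
over the outcomes for which the resources first give the outputs `h`. -/
noncomputable def prefixSum {Ω : Type*} (π : Ω → ∀ i, Fin (m i) → X i)
    (Φ : Ω → (∀ i, Fin (m i) → A i) → Y → ℝ≥0∞) {c : ι → ℕ} (t : ResourceProgram A X m Y c)
    (d : ∀ i, Fin (m i) → A i) (h : ∀ i, Fin (m i) → X i) : ℝ≥0∞ :=
  ∑' ω, {ω | Agree c (π ω) h}.indicator
    (fun ω => Φ ω (t.inputs d (π ω)) (t.response (π ω))) ω

/-- Each outcome follows exactly one branch, the one labelled by the output it gives to this query.
-/
lemma prefixSum_query {Ω : Type*} (π : Ω → ∀ i, Fin (m i) → X i)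
    (Φ : Ω → (∀ i, Fin (m i) → A i) → Y → ℝ≥0∞) {c : ι → ℕ} (i : ι) (hi : c i < m i) (a : A i)
    (k : X i → ResourceProgram A X m Y (Function.update c i (c i + 1)))
    (d : ∀ i, Fin (m i) → A i) (h : ∀ i, Fin (m i) → X i) :
    prefixSum π Φ (query i hi a k) d h =
      ∑' y, prefixSum π Φ (k y) (setRound d i ⟨c i, hi⟩ a) (setRound h i ⟨c i, hi⟩ y) := by
  classical
  unfold prefixSum
  rw [ENNReal.tsum_comm]
  refine tsum_congr fun ω => ?_
  simp only [Set.indicator_apply, Set.mem_ofPred_eq, agree_setRound_iff]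
  rw [tsum_eq_single (π ω i ⟨c i, hi⟩) fun y hy => if_neg fun H => hy H.2.symm]
  simp only [and_true, inputs_query]
  rfl

end ResourceProgram

/-! ### Marginals of one resource at one player -/

/-- Sum of `φ` over the outputs of a resource that start with `h` in the first `n` rounds of
player `v`, if the inputs are `a`, and `d` for player `v`. -/
noncomputable def NonSignalingResource.marginal {P : Type*} [DecidableEq P]
    (R : NonSignalingResource P) (v : P) (a : ∀ p, Fin (R.rounds p) → R.In p)
    (φ : (∀ p, Fin (R.rounds p) → R.Out p) → ℝ≥0∞) (n : ℕ) (d : Fin (R.rounds v) → R.In v)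
    (h : Fin (R.rounds v) → R.Out v) : ℝ≥0∞ :=
  ∑' w, R.law (Function.update a v d) w *
    {w | ∀ r : Fin (R.rounds v), r.1 < n → w v r = h r}.indicator φ w

/-- This is where non-signaling enters: once the output of round `n` is summed out, nothing left
depends on that round of `v`, so its input `b` is irrelevant. -/
lemma NonSignalingResource.tsum_marginal_succ {P : Type*} [DecidableEq P]
    (R : NonSignalingResource P) (v : P) (a : ∀ p, Fin (R.rounds p) → R.In p)
    {φ : (∀ p, Fin (R.rounds p) → R.Out p) → ℝ≥0∞}
    (hφ : ∀ w w', (∀ p, p ≠ v → w p = w' p) → φ w = φ w') {n : ℕ} (hn : n < R.rounds v)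
    (d : Fin (R.rounds v) → R.In v) (h : Fin (R.rounds v) → R.Out v) (b : R.In v) :
    ∑' y, R.marginal v a φ (n + 1) (Function.update d ⟨n, hn⟩ b) (Function.update h ⟨n, hn⟩ y) =
      R.marginal v a φ n d h := by
  classical
  unfold marginal
  have hsum : ∀ w : ∀ p, Fin (R.rounds p) → R.Out p,
      ∑' y, R.law (Function.update a v (Function.update d ⟨n, hn⟩ b)) w *
        {w | ∀ r : Fin (R.rounds v), r.1 < n + 1 →
          w v r = Function.update h ⟨n, hn⟩ y r}.indicator φ w =
      R.law (Function.update a v (Function.update d ⟨n, hn⟩ b)) w *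
        {w | ∀ r : Fin (R.rounds v), r.1 < n → w v r = h r}.indicator φ w := by
    intro w
    rw [ENNReal.tsum_mul_left]
    congr 1
    simp only [Set.indicator_apply, Set.mem_ofPred_eq,
      ResourceProgram.update_eq_iff_of_lt_succ hn]
    rw [tsum_eq_single (w v ⟨n, hn⟩) fun y hy => if_neg fun H => hy H.2.symm]
    simp
  rw [ENNReal.tsum_comm, tsum_congr hsum, R.tsum_law_congr v n (a' := Function.update a v d)]
  · exact fun p hp => by simp [hp]
  · intro r hr
    simp only [Function.update_self]
    rw [Function.update_of_ne]
    rintro rfl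
    simp at hr
  · intro w w' h1 h2
    simp only [Set.indicator_apply, Set.mem_ofPred_eq]
    rw [hφ w w' h1]
    congr 1
    refine propext (forall_congr' fun r => forall_congr' fun hr => ?_)
    rw [h2 r hr]

lemma NonSignalingResource.marginal_zero {P : Type*} [DecidableEq P]
    (R : NonSignalingResource P) (v : P) (a : ∀ p, Fin (R.rounds p) → R.In p)
    {φ : (∀ p, Fin (R.rounds p) → R.Out p) → ℝ≥0∞} (d : Fin (R.rounds v) → R.In v)
    (h : Fin (R.rounds v) → R.Out v) :
    R.marginal v a φ 0 d h = ∑' w, R.law (Function.update a v d) w * φ w := by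
  simp [marginal]

/-! ### Independence of the queries of other players -/

namespace NonlocalGame

lemma outputs_nonempty {P ι : Type*} (ρ : ι → NonSignalingResource P) : Nonempty (Outputs ρ) :=
  ⟨fun i => ((ρ i).law (fun p _ => Classical.choice ((ρ i).nonempty_in p))).support_nonempty.some⟩

variable {P : Type*} {ι : Type*} [DecidableEq ι] (ρ : ι → NonSignalingResource P)

/-- The adaptive queries of all the players. -/
abbrev Trees : Type _ := ∀ p : P, ResourceProgram (fun i => (ρ i).In p) (fun i => (ρ i).Out p)
  (fun i => (ρ i).rounds p) Unit 0

/-- The inputs that fill the unused rounds. -/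
noncomputable def defaultInputs (p : P) (i : ι) : Fin ((ρ i).rounds p) → (ρ i).In p :=
  fun _ => Classical.choice ((ρ i).nonempty_in p)

variable {ρ}

/-- The inputs given to the resources, if their outputs are `x`. -/
noncomputable def treeInputs (τ : Trees ρ) (x : Outputs ρ) (i : ι) (p : P) :
    Fin ((ρ i).rounds p) → (ρ i).In p :=
  (τ p).inputs (defaultInputs ρ p) (fun i => x i p) i

/-- The probability that the resources give the outputs `x`. -/
noncomputable def weight [Fintype ι] (τ : Trees ρ) (x : Outputs ρ) : ℝ≥0∞ :=
  ∏ i, (ρ i).law (treeInputs τ x i) (x i)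

variable [DecidableEq P] [Fintype ι]

-- The value does not involve `t`. At a leaf the sum factors over the resources; at a query only the
-- factor of the queried resource changes, and summing over the output restores it by
-- `tsum_marginal_succ`. Hence adaptivity across resources does no harm.
open ResourceProgram in
lemma prefixSum_eq_prod_marginal {Y : Type*} (v : P)
    (a : ∀ i p, Fin ((ρ i).rounds p) → (ρ i).In p)
    (φ : ∀ i, (∀ p, Fin ((ρ i).rounds p) → (ρ i).Out p) → ℝ≥0∞)
    (hφ : ∀ i w w', (∀ p, p ≠ v → w p = w' p) → φ i w = φ i w') {c : ι → ℕ}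
    (t : ResourceProgram (fun i => (ρ i).In v) (fun i => (ρ i).Out v)
      (fun i => (ρ i).rounds v) Y c)
    (d : ∀ i, Fin ((ρ i).rounds v) → (ρ i).In v) (h : ∀ i, Fin ((ρ i).rounds v) → (ρ i).Out v) :
    prefixSum (fun (x : Outputs ρ) i => x i v)
      (fun x b _ => ∏ i, ((ρ i).law (Function.update (a i) v (b i)) (x i) * φ i (x i))) t d h =
    ∏ i, (ρ i).marginal v (a i) (φ i) (c i) (d i) (h i) := by
  classical
  induction t generalizing d h with
  | @answer c y =>
    unfold prefixSum NonSignalingResource.marginal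
    rw [← ENNReal.tsum_pi_prod]
    refine tsum_congr fun x => ?_
    simp only [Set.indicator_apply, Set.mem_ofPred_eq, Agree, inputs]
    by_cases hx : ∀ i (r : Fin ((ρ i).rounds v)), r.1 < c i → x i v r = h i r
    · rw [if_pos hx]
      exact Finset.prod_congr rfl fun i _ => by rw [if_pos (hx i)]
    · rw [if_neg hx]
      rw [not_forall] at hx
      obtain ⟨i, hi⟩ := hx
      exact (Finset.prod_eq_zero (Finset.mem_univ i) (by rw [if_neg hi, mul_zero])).symm
  | @query c i hi b k ih =>
    rw [prefixSum_query]
    simp only [ih]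
    rw [← Finset.mul_prod_erase _ _ (Finset.mem_univ i),
      ← (ρ i).tsum_marginal_succ v (a i) (hφ i) hi (d i) (h i) b, ← ENNReal.tsum_mul_right]
    refine tsum_congr fun y => ?_
    rw [← Finset.mul_prod_erase _ _ (Finset.mem_univ i)]
    simp only [setRound_self, Function.update_self]
    congr 1
    refine Finset.prod_congr rfl fun j hj => ?_
    have hj := Finset.ne_of_mem_erase hj
    rw [Function.update_of_ne hj, setRound_of_ne _ hj, setRound_of_ne _ hj]

/-- The outputs for the players other than `v` do not depend on the queries of `v`. -/
lemma tsum_weight_congr_of_ne (v : P) {τ τ' : Trees ρ} (hτ : ∀ p, p ≠ v → τ p = τ' p)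
    (f : Outputs ρ → ℝ≥0∞) (hf : ∀ x x', (∀ i p, p ≠ v → x i p = x' i p) → f x = f x') :
    ∑' x, weight τ x * f x = ∑' x, weight τ' x * f x := by
  classical
  let rest : Outputs ρ → ∀ i (p : {p // p ≠ v}), Fin ((ρ i).rounds p) → (ρ i).Out p :=
    fun x i p => x i p
  have hfac : Function.FactorsThrough f rest := fun x x' h =>
    hf x x' fun i p hp => congrFun (congrFun h i) ⟨p, hp⟩
  obtain ⟨e, rfl⟩ := (Function.factorsThrough_iff _).1 hfac
  obtain ⟨x₀⟩ := outputs_nonempty ρ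
  -- Once the outputs `g` of the others are fixed, so are their inputs. The entry for `v` is a dummy
  -- that is always overwritten.
  let a : (∀ i (p : {p // p ≠ v}), Fin ((ρ i).rounds p) → (ρ i).Out p) →
      ∀ i p, Fin ((ρ i).rounds p) → (ρ i).In p := fun g i p =>
    if hp : p ≠ v then (τ p).inputs (defaultInputs ρ p) (fun i => g i ⟨p, hp⟩) i
    else defaultInputs ρ p i
  let φ : (∀ i (p : {p // p ≠ v}), Fin ((ρ i).rounds p) → (ρ i).Out p) →
      ∀ i, (∀ p, Fin ((ρ i).rounds p) → (ρ i).Out p) → ℝ≥0∞ := fun g i w =>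
    if (fun p : {p // p ≠ v} => w p) = g i then 1 else 0
  -- The right-hand side does not mention `σ v`. The table `x₀` is arbitrary, as a prefix of length
  -- zero imposes nothing.
  have main : ∀ σ : Trees ρ, (∀ p, p ≠ v → σ p = τ p) →
      ∑' x, weight σ x * (e ∘ rest) x = ∑' g, e g *
        ∏ i, (ρ i).marginal v (a g i) (φ g i) 0 (defaultInputs ρ v i) (x₀ i v) := by
    intro σ hσ
    have h1 : ∀ x, weight σ x * (e ∘ rest) x =
        ∑' g, e g * (weight σ x * if rest x = g then 1 else 0) := by
      intro x
      rw [tsum_eq_single (rest x) fun g hg => by simp [hg.symm]]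
      simp [mul_comm]
    rw [tsum_congr h1, ENNReal.tsum_comm]
    refine tsum_congr fun g => ?_
    rw [ENNReal.tsum_mul_left]
    congr 1
    have h2 := prefixSum_eq_prod_marginal v (a g) (φ g) (fun i w w' h => by
      have : (fun p : {p // p ≠ v} => w p) = fun p : {p // p ≠ v} => w' p := funext fun p => h p p.2
      simp only [φ, this]) (σ v) (defaultInputs ρ v) (fun i => x₀ i v)
    rw [show (∏ i, (ρ i).marginal v (a g i) (φ g i) 0 (defaultInputs ρ v i) (x₀ i v)) = _
      from h2.symm]
    unfold ResourceProgram.prefixSum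
    refine tsum_congr fun x => ?_
    rw [Set.indicator_of_mem (by intro i r hr; simp at hr)]
    dsimp only
    rw [Finset.prod_mul_distrib]
    by_cases hx : rest x = g
    · rw [if_pos hx, mul_one, Finset.prod_eq_one (f := fun i => φ g i (x i)), mul_one]
      · refine Finset.prod_congr rfl fun i _ => ?_
        congr 2
        funext p
        by_cases hp : p = v
        · subst hp
          simp [treeInputs]
        · simp [treeInputs, hp, a, hσ p hp, ← hx, rest]
      · exact fun i _ => if_pos (congrFun hx i)
    · rw [if_neg hx, mul_zero]
      obtain ⟨i, hi⟩ := Function.ne_iff.1 hx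
      rw [Finset.prod_eq_zero (f := fun i => φ g i (x i)) (Finset.mem_univ i) (if_neg hi), mul_zero]
  rw [main τ fun _ _ => rfl, main τ' fun p hp => (hτ p hp).symm]

/-- The outputs for the players in a set do not depend on the queries of the other players. -/
lemma tsum_weight_congr [Fintype P] (T : Set P) {τ τ' : Trees ρ} (hτ : ∀ p ∈ T, τ p = τ' p)
    (f : Outputs ρ → ℝ≥0∞) (hf : ∀ x x', (∀ i, ∀ p ∈ T, x i p = x' i p) → f x = f x') :
    ∑' x, weight τ x * f x = ∑' x, weight τ' x * f x := by
  classical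
  -- Hybrid argument: the programs of the players outside `T` are exchanged one at a time.
  have main : ∀ s : Finset P, (∀ p ∈ s, p ∉ T) →
      ∑' x, weight τ x * f x = ∑' x, weight (fun p => if p ∈ s then τ' p else τ p) x * f x := by
    intro s
    induction s using Finset.induction_on with
    | empty => simp
    | insert v s hv ih =>
      intro hs
      rw [ih fun p hp => hs p (Finset.mem_insert_of_mem hp)]
      refine tsum_weight_congr_of_ne v (fun p hp => by simp [hp]) f fun x x' h => ?_
      exact hf x x' fun i p hp => h i p fun e => hs v (Finset.mem_insert_self v s) (e ▸ hp)
  rw [main (Finset.univ.filter (· ∉ T)) (by simp)]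
  congr! 4 with x
  funext p
  by_cases hp : p ∈ T <;> simp [hp, hτ]

/-- With no player relevant, all programs may be replaced by ones without queries, which leaves a
product of probability distributions. -/
lemma tsum_weight [Fintype P] (τ : Trees ρ) : ∑' x, weight τ x = 1 := by
  have := tsum_weight_congr ∅ (τ := τ) (τ' := fun _ => .answer ()) (by simp) (fun _ => 1)
    (fun _ _ _ => rfl)
  simp only [mul_one] at this
  rw [this]
  refine (ENNReal.tsum_pi_prod (fun i => (ρ i).law (fun p => defaultInputs ρ p i))).trans ?_
  simp

end NonlocalGame

/-! ### Removing one resource from a program -/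

namespace ResourceProgram

variable {ι : Type*} [DecidableEq ι] {A X : ι → Type*} {m : ι → ℕ} {Y : Type*}

lemma Ignores.inputs_congr {R : ι} {c : ι → ℕ} {t : ResourceProgram A X m Y c} (ht : t.Ignores R)
    (d : ∀ i, Fin (m i) → A i) {x x' : ∀ i, Fin (m i) → X i} (h : ∀ i, i ≠ R → x i = x' i) :
    t.inputs d x = t.inputs d x' := by
  induction t with
  | answer y => rfl
  | query i hi a k ih =>
    simp only [inputs]
    rw [h i ht.1, ih _ (ht.2 _)]

lemma Ignores.response_congr {R : ι} {c : ι → ℕ} {t : ResourceProgram A X m Y c}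
    (ht : t.Ignores R) {x x' : ∀ i, Fin (m i) → X i} (h : ∀ i, i ≠ R → x i = x' i) :
    t.response x = t.response x' := by
  induction t with
  | answer y => rfl
  | query i hi a k ih =>
    simp only [response]
    rw [h i ht.1, ih _ (ht.2 _)]

end ResourceProgram

namespace NonlocalGame

open ResourceProgram

variable {P : Type*} [DecidableEq P] {ι : Type*} [DecidableEq ι] [Fintype ι]
  {ρ : ι → NonSignalingResource P} {Y : Type*}

/-- The weight of the outputs `x` times `F x y`, if the inputs are `a x`, and `b` for player `v`. -/
noncomputable def fullWeight (v : P) (a : Outputs ρ → ∀ i p, Fin ((ρ i).rounds p) → (ρ i).In p)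
    (F : Outputs ρ → Y → ℝ≥0∞) (x : Outputs ρ) (b : ∀ i, Fin ((ρ i).rounds v) → (ρ i).In v)
    (y : Y) : ℝ≥0∞ :=
  (∏ i, (ρ i).law (Function.update (a x i) v (b i)) (x i)) * F x y

/-- The variant of `fullWeight` without the resource `R`, whose outputs are fixed to be `g`. -/
noncomputable def pinnedWeight (v : P) (R : ι) (g : ∀ p, Fin ((ρ R).rounds p) → (ρ R).Out p)
    (a : Outputs ρ → ∀ i p, Fin ((ρ i).rounds p) → (ρ i).In p)
    (F : Outputs ρ → Y → ℝ≥0∞) (x : Outputs ρ) (b : ∀ i, Fin ((ρ i).rounds v) → (ρ i).In v)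
    (y : Y) : ℝ≥0∞ :=
  {x : Outputs ρ | x R = g}.indicator (fun x =>
    (∏ i ∈ Finset.univ.erase R, (ρ i).law (Function.update (a x i) v (b i)) (x i)) * F x y) x

variable {v : P} {R : ι} {g : ∀ p, Fin ((ρ R).rounds p) → (ρ R).Out p}
    {a : Outputs ρ → ∀ i p, Fin ((ρ i).rounds p) → (ρ i).In p} {F : Outputs ρ → Y → ℝ≥0∞}

lemma prefixSum_pinnedWeight_congr {c : ι → ℕ} (hc : c R = 0)
    (t : ResourceProgram (fun i => (ρ i).In v) (fun i => (ρ i).Out v)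
      (fun i => (ρ i).rounds v) Y c)
    {d d' : ∀ i, Fin ((ρ i).rounds v) → (ρ i).In v} (hd : ∀ i, i ≠ R → d i = d' i)
    {h h' : ∀ i, Fin ((ρ i).rounds v) → (ρ i).Out v} (hh : ∀ i, i ≠ R → h i = h' i) :
    prefixSum (fun (x : Outputs ρ) i => x i v) (pinnedWeight v R g a F) t d h =
      prefixSum (fun (x : Outputs ρ) i => x i v) (pinnedWeight v R g a F) t d' h' := by
  classical
  unfold prefixSum
  refine tsum_congr fun x => ?_
  simp only [Set.indicator_apply, Set.mem_ofPred_eq]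
  have h1 : Agree c (fun i => x i v) h ↔ Agree c (fun i => x i v) h' := by
    refine forall_congr' fun i => ?_
    by_cases hi : i = R
    · subst hi
      simp [hc]
    · rw [hh i hi]
  have h2 : pinnedWeight v R g a F x (t.inputs d fun i => x i v) (t.response fun i => x i v) =
      pinnedWeight v R g a F x (t.inputs d' fun i => x i v) (t.response fun i => x i v) := by
    unfold pinnedWeight
    congr 1
    funext x'
    congr 1
    refine Finset.prod_congr rfl fun i hi => ?_
    rw [ResourceProgram.inputs_congr t _ (hd i (Finset.ne_of_mem_erase hi))]
  simp only [h1, h2]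

/-- At a leaf all inputs of `v` are known, and neither `F` nor the other players react to `R`, so
the sum over the outputs of `R` splits off. -/
lemma prefixSum_answer_eq_mul_marginal
    (ha : ∀ x w i, a (Function.update x R w) i = a x i) (aR : ∀ p, Fin ((ρ R).rounds p) → (ρ R).In p)
    (haR : ∀ x, Function.update (a x R) v = Function.update aR v)
    (hF : ∀ x w, F (Function.update x R w) = F x) {c c' : ι → ℕ} (hc : ∀ i, i ≠ R → c' i = c i)
    (hcR : c' R = 0) (y : Y) (d : ∀ i, Fin ((ρ i).rounds v) → (ρ i).In v)
    (h : ∀ i, Fin ((ρ i).rounds v) → (ρ i).Out v) :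
    prefixSum (fun (x : Outputs ρ) i => x i v) (fullWeight v a F) (.answer (c := c) y) d h =
      prefixSum (fun (x : Outputs ρ) i => x i v) (pinnedWeight v R g a F) (.answer (c := c') y) d h *
        (ρ R).marginal v aR (fun _ => 1) (c R) (d R) (h R) := by
  classical
  unfold prefixSum NonSignalingResource.marginal
  rw [ENNReal.tsum_pi_eq_mul R g _ ({x : Outputs ρ | Agree c' (fun i => x i v) h}.indicator
    fun x => (∏ i ∈ Finset.univ.erase R, (ρ i).law (Function.update (a x i) v (d i)) (x i)) * F x y)]
  · congr 1
    refine tsum_congr fun x => ?_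
    simp only [Set.indicator_apply, Set.mem_ofPred_eq, pinnedWeight, inputs, response]
    by_cases h1 : x R = g <;> by_cases h2 : Agree c' (fun i => x i v) h <;> simp [h1, h2]
  · intro x w _
    have hagree : Agree c (fun i => Function.update x R w i v) h ↔
        Agree c' (fun i => x i v) h ∧ ∀ r : Fin ((ρ R).rounds v), r.1 < c R → w v r = h R r := by
      constructor
      · refine fun H => ⟨fun i r hr => ?_, fun r hr => by simpa using H R r hr⟩
        by_cases hi : i = R
        · subst hi; omega
        · simpa [hi] using H i r (hc i hi ▸ hr)
      · rintro ⟨H1, H2⟩ i r hr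
        by_cases hi : i = R
        · subst hi; simpa using H2 r hr
        · simpa [hi] using H1 i r ((hc i hi).symm ▸ hr)
    simp only [Set.indicator_apply, Set.mem_ofPred_eq, hagree, inputs, response, fullWeight]
    by_cases h1 : Agree c' (fun i => x i v) h <;>
      by_cases h2 : ∀ r : Fin ((ρ R).rounds v), r.1 < c R → w v r = h R r
    · rw [if_pos ⟨h1, h2⟩, if_pos h1, if_pos h2, ← Finset.mul_prod_erase _ _ (Finset.mem_univ R), hF,
        ha, haR, Function.update_self, mul_one, mul_assoc, mul_comm]
      congr 2
      refine Finset.prod_congr rfl fun i hi => ?_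
      rw [ha, Function.update_of_ne (Finset.ne_of_mem_erase hi)]
    all_goals simp [h1, h2]

/-- The factor `marginal` is the probability that `R` produced the part of its outputs already in
`h`; carrying it along makes the greedy choice an induction. The new program has its own counter
`c'`, since it never advances the one of `R`. -/
lemma exists_ignores_prefixSum_le
    (ha : ∀ x w i, a (Function.update x R w) i = a x i) (aR : ∀ p, Fin ((ρ R).rounds p) → (ρ R).In p)
    (haR : ∀ x, Function.update (a x R) v = Function.update aR v)
    (hF : ∀ x w, F (Function.update x R w) = F x) {c : ι → ℕ}
    (t : ResourceProgram (fun i => (ρ i).In v) (fun i => (ρ i).Out v)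
      (fun i => (ρ i).rounds v) Y c)
    (d : ∀ i, Fin ((ρ i).rounds v) → (ρ i).In v) (h : ∀ i, Fin ((ρ i).rounds v) → (ρ i).Out v)
    {c' : ι → ℕ} (hc : ∀ i, i ≠ R → c' i = c i) (hcR : c' R = 0) :
    ∃ t' : ResourceProgram (fun i => (ρ i).In v) (fun i => (ρ i).Out v)
      (fun i => (ρ i).rounds v) Y c', t'.Ignores R ∧
      prefixSum (fun (x : Outputs ρ) i => x i v) (pinnedWeight v R g a F) t' d h *
        (ρ R).marginal v aR (fun _ => 1) (c R) (d R) (h R) ≤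
      prefixSum (fun (x : Outputs ρ) i => x i v) (fullWeight v a F) t d h := by
  induction t generalizing d h c' with
  | @answer c y =>
    exact ⟨.answer y, trivial, (prefixSum_answer_eq_mul_marginal ha aR haR hF hc hcR y d h).ge⟩
  | @query c i hi b k ih =>
    by_cases hiR : i = R
    · subst hiR
      choose T hT hle using fun y => ih y (setRound d i ⟨c i, hi⟩ b) (setRound h i ⟨c i, hi⟩ y)
        (c' := c') (fun j hj => by rw [hc j hj, Function.update_of_ne hj]) hcR
      have hne : Nonempty ((ρ i).Out v) :=
        (outputs_nonempty ρ).map fun x => x i v ⟨c i, hi⟩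
      have hsum := (ρ i).tsum_marginal_succ v aR (φ := fun _ => 1) (fun _ _ _ => rfl) hi (d i) (h i) b
      have hfin : (ρ i).marginal v aR (fun _ => 1) (c i) (d i) (h i) ≠ ∞ := by
        refine ne_top_of_le_ne_top ENNReal.one_ne_top (le_of_le_of_eq (ENNReal.tsum_le_tsum
          fun w => ?_) ((ρ i).law (Function.update aR v (d i))).tsum_coe)
        exact mul_le_of_le_one_right' (Set.indicator_le' (fun _ _ => le_rfl) (fun _ _ => zero_le) w)
      -- The marginals for the possible outputs sum to the current one, so some `y` does at least as
      -- well as the average; the new program continues as if `R` had returned it.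
      obtain ⟨y, hy⟩ := ENNReal.exists_mul_tsum_le _
        (fun y => prefixSum (fun (x : Outputs ρ) i => x i v) (pinnedWeight v i g a F) (T y) d h)
        (hsum ▸ hfin)
      refine ⟨T y, hT y, ?_⟩
      rw [hsum] at hy
      refine hy.trans ?_
      rw [prefixSum_query]
      refine ENNReal.tsum_le_tsum fun y => le_trans (le_of_eq ?_) (hle y)
      rw [setRound_self, setRound_self, Function.update_self]
      congr 1
      -- The induction hypothesis has the query to `R` recorded in its tables, but the pinned sum
      -- does not read the entries of `R`.
      exact prefixSum_pinnedWeight_congr hcR _ (fun j hj => (setRound_of_ne _ hj _ _).symm)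
        (fun j hj => (setRound_of_ne _ hj _ _).symm)
    · choose T hT hle using fun y => ih y (setRound d i ⟨c i, hi⟩ b) (setRound h i ⟨c i, hi⟩ y)
        (c' := Function.update c' i (c' i + 1)) (fun j hj => by
          by_cases hji : j = i
          · subst hji; simp [hc j hj]
          · simp [hji, hc j hj]) (by rw [Function.update_of_ne (Ne.symm hiR), hcR])
      have hci := hc i hiR
      refine ⟨.query i (hci ▸ hi) b T, ⟨hiR, hT⟩, ?_⟩
      rw [prefixSum_query, prefixSum_query, ← ENNReal.tsum_mul_right]
      refine ENNReal.tsum_le_tsum fun y => le_trans (le_of_eq ?_) (hle y)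
      rw [setRound_of_ne _ (Ne.symm hiR), setRound_of_ne _ (Ne.symm hiR),
        Function.update_of_ne (Ne.symm hiR)]
      simp only [hci]

/-- For a program that ignores `R`, its inputs to `R` are the defaults, and the law of `R` sums to
one. -/
lemma prefixSum_fullWeight_eq_pinnedWeight
    (ha : ∀ x w i, a (Function.update x R w) i = a x i) (aR : ∀ p, Fin ((ρ R).rounds p) → (ρ R).In p)
    (haR : ∀ x, Function.update (a x R) v = Function.update aR v)
    (hF : ∀ x w, F (Function.update x R w) = F x)
    {t : ResourceProgram (fun i => (ρ i).In v) (fun i => (ρ i).Out v)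
      (fun i => (ρ i).rounds v) Y 0} (ht : t.Ignores R)
    (d : ∀ i, Fin ((ρ i).rounds v) → (ρ i).In v) (h : ∀ i, Fin ((ρ i).rounds v) → (ρ i).Out v) :
    prefixSum (fun (x : Outputs ρ) i => x i v) (fullWeight v a F) t d h =
      prefixSum (fun (x : Outputs ρ) i => x i v) (pinnedWeight v R g a F) t d h := by
  classical
  unfold prefixSum
  have hagree : ∀ x : Outputs ρ, Agree 0 (fun i => x i v) h := fun x i r hr => by simp at hr
  simp only [hagree, Set.ofPred_true, Set.indicator_univ]
  rw [ENNReal.tsum_pi_eq_mul R g _ (fun x => (∏ i ∈ Finset.univ.erase R,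
      (ρ i).law (Function.update (a x i) v (t.inputs d (fun i => x i v) i)) (x i)) *
        F x (t.response fun i => x i v)) (fun w => (ρ R).law (Function.update aR v (d R)) w)]
  · rw [PMF.tsum_coe, mul_one]
    rfl
  · intro x w _
    have hx : ∀ i, i ≠ R → (fun i => Function.update x R w i v) i = x i v := fun i hi => by simp [hi]
    rw [ht.inputs_congr d hx, ht.response_congr hx]
    unfold fullWeight
    rw [← Finset.mul_prod_erase _ _ (Finset.mem_univ R), hF, ha, haR, ht.inputs_eq,
      Function.update_self, mul_assoc, mul_comm]
    congr 2
    refine Finset.prod_congr rfl fun i hi => ?_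
    rw [ha, Function.update_of_ne (Finset.ne_of_mem_erase hi)]

/-- If the other players whose responses matter are no parties of the resource `R`, then a player
does not lose by fixing the outputs of `R`. -/
lemma exists_ignores_tsum_le (τ : Trees ρ)
    (hτ : ∀ p, p ≠ v → ∀ x w i, treeInputs τ (Function.update x R w) i p = treeInputs τ x i p)
    (hτR : ∀ p, p ≠ v → ∀ x x', treeInputs τ x R p = treeInputs τ x' R p)
    (hF : ∀ x w, F (Function.update x R w) = F x)
    (t : ResourceProgram (fun i => (ρ i).In v) (fun i => (ρ i).Out v)
      (fun i => (ρ i).rounds v) Y 0) :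
    ∃ t' : ResourceProgram (fun i => (ρ i).In v) (fun i => (ρ i).Out v)
      (fun i => (ρ i).rounds v) Y 0, t'.Ignores R ∧
      ∑' x, weight (Function.update τ v t'.forget) x * F x (t'.response fun i => x i v) ≤
      ∑' x, weight (Function.update τ v t.forget) x * F x (t.response fun i => x i v) := by
  obtain ⟨x₀⟩ := outputs_nonempty ρ
  let a : Outputs ρ → ∀ i p, Fin ((ρ i).rounds p) → (ρ i).In p := fun x i p =>
    if p = v then defaultInputs ρ p i else treeInputs τ x i p
  have ha : ∀ x w i, a (Function.update x R w) i = a x i := fun x w i => by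
    funext p
    by_cases hp : p = v
    · simp [a, hp]
    · simp [a, hp, hτ p hp]
  have haR : ∀ x, Function.update (a x R) v = Function.update (a x₀ R) v := fun x => by
    congr 1
    funext p
    by_cases hp : p = v
    · simp [a, hp]
    · simp only [a, if_neg hp, hτR p hp x x₀]
  have key : ∀ s : ResourceProgram (fun i => (ρ i).In v) (fun i => (ρ i).Out v)
      (fun i => (ρ i).rounds v) Y 0,
      ∑' x, weight (Function.update τ v s.forget) x * F x (s.response fun i => x i v) =
      prefixSum (fun (x : Outputs ρ) i => x i v) (fullWeight v a F) s (defaultInputs ρ v)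
        (fun i => x₀ i v) := by
    intro s
    unfold prefixSum
    refine tsum_congr fun x => ?_
    rw [Set.indicator_of_mem (by intro i r hr; simp at hr)]
    unfold fullWeight weight
    congr 1
    refine Finset.prod_congr rfl fun i _ => ?_
    congr 2
    funext p
    by_cases hp : p = v
    · subst hp
      simp [treeInputs, inputs_forget]
    · simp [treeInputs, hp, a]
  obtain ⟨t', ht', hle⟩ := exists_ignores_prefixSum_le (g := x₀ R) ha (a x₀ R) haR hF t
    (defaultInputs ρ v) (fun i => x₀ i v) (fun _ _ => rfl) rfl
  refine ⟨t', ht', ?_⟩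
  rw [key, key, prefixSum_fullWeight_eq_pinnedWeight (g := x₀ R) ha (a x₀ R) haR hF ht']
  refine le_trans (le_of_eq ?_) hle
  rw [show (0 : ι → ℕ) R = 0 from rfl, NonSignalingResource.marginal_zero]
  simp

end NonlocalGame

/-! ### Loss probabilities and their transfer between questions -/

namespace NonlocalGame

section Dependence

variable {P : Type*} {G : NonlocalGame P}

lemma DependsOn.isSome {q : G.Question} {p : P} (h : G.DependsOn q p) : (q p).isSome := by
  obtain ⟨r, r', hr, h1, h2⟩ := h
  by_contra hp
  have : r = r' := funext fun u => hr u fun e => hp (e ▸ u.2)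
  exact h2 (this ▸ h1)

/-- Acceptance is determined by the responses on which it depends. -/
lemma accept_congr [Finite P] {q : G.Question} {r r' : G.Responses q}
    (h : ∀ p : {p // (q p).isSome}, G.DependsOn q p → r p = r' p) :
    G.accept q r ↔ G.accept q r' := by
  classical
  have := Fintype.ofFinite P
  have main : ∀ s : Finset P,
      G.accept q r ↔ G.accept q (fun p => if p.1 ∈ s then r' p else r p) := by
    intro s
    induction s using Finset.induction_on with
    | empty => simp
    | insert v s hv ih =>
      rw [ih]
      by_cases hd : G.DependsOn q v
      · have : (fun p : {p // (q p).isSome} => if p.1 ∈ insert v s then r' p else r p) =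
            fun p => if p.1 ∈ s then r' p else r p := by
          funext p
          by_cases hp : p.1 = v
          · rw [h p (hp ▸ hd), ite_self, ite_self]
          · simp [hp]
        rw [this]
      · have hagree : ∀ u : {p // (q p).isSome}, u.1 ≠ v →
            (if u.1 ∈ s then r' u else r u) = if u.1 ∈ insert v s then r' u else r u := by
          intro u hu
          simp [hu]
        constructor
        · intro h1
          by_contra h2
          exact hd ⟨_, _, hagree, h1, h2⟩
        · intro h1
          by_contra h2
          exact hd ⟨_, _, fun u hu => (hagree u hu).symm, h1, h2⟩
  simpa using main Finset.univ

end Dependence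

variable {P : Type*} {G : NonlocalGame P} {ι : Type*} [DecidableEq ι]
  {ρ : ι → NonSignalingResource P} {Λ : Type*}

/-- The queries of the players on question `q`. -/
def tree (S : G.Strategy ρ Λ) (l : Λ) (q : G.Question) : Trees ρ := fun p =>
  match q p with
  | none => .answer ()
  | some z => (S l p z).forget

lemma treeInputs_tree (S : G.Strategy ρ Λ) (l : Λ) (q : G.Question) :
    treeInputs (tree S l q) = resourceInputs S l q := by
  funext x i p
  unfold treeInputs resourceInputs tree
  cases q p with
  | none => rfl
  | some z =>
    simp only [ResourceProgram.inputs_forget]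
    rfl

lemma tree_congr {S S' : G.Strategy ρ Λ} {l : Λ} {q q' : G.Question} {p : P} (hq : q p = q' p)
    (hS : ∀ z, q p = some z → S l p z = S' l p z) : tree S l q p = tree S' l q' p := by
  unfold tree
  rw [← hq]
  cases h : q p with
  | none => rfl
  | some z => simp only [hS z h]

lemma responses_congr {S S' : G.Strategy ρ Λ} {l : Λ} {q : G.Question} {x x' : Outputs ρ}
    {p : {p // (q p).isSome}} (hx : ∀ i, x i p = x' i p)
    (hS : ∀ z, q p = some z → S l p z = S' l p z) :
    responses S l q x p = responses S' l q x' p := by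
  unfold responses
  rw [hS _ (Option.some_get p.2).symm]
  simp only [hx]

/-- Indicator function of the event that the strategy loses. -/
noncomputable def loss (S : G.Strategy ρ Λ) (l : Λ) (q : G.Question) (x : Outputs ρ) : ℝ≥0∞ :=
  {r | ¬ G.accept q r}.indicator 1 (responses S l q x)

lemma indicator_congr [Finite P] {q : G.Question} {r r' : G.Responses q}
    (h : ∀ p : {p // (q p).isSome}, G.DependsOn q p → r p = r' p) :
    ({r | ¬ G.accept q r}.indicator 1 r : ℝ≥0∞) = {r | ¬ G.accept q r}.indicator 1 r' := by
  classical
  simp only [Set.indicator_apply, Set.mem_ofPred_eq, accept_congr h]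
  rfl

variable [Fintype ι]

/-- The probability that the strategy loses for a fixed value of the randomness. -/
noncomputable def loseAt (S : G.Strategy ρ Λ) (l : Λ) (q : G.Question) : ℝ≥0∞ :=
  ∑' x, weight (tree S l q) x * loss S l q x

lemma prob_eq (μ : PMF Λ) (S : G.Strategy ρ Λ) (q : G.Question) (E : Set (G.Responses q)) :
    prob μ S q E =
      ∑' l, μ l * ∑' x, weight (tree S l q) x * E.indicator 1 (responses S l q x) := by
  unfold prob weight
  simp only [treeInputs_tree, ← ENNReal.tsum_mul_left, mul_assoc]

lemma prob_lose_eq (μ : PMF Λ) (S : G.Strategy ρ Λ) (q : G.Question) :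
    prob μ S q {r | ¬ G.accept q r} = ∑' l, μ l * loseAt S l q :=
  prob_eq μ S q _

variable [DecidableEq P] [Fintype P]

lemma prob_win_add_lose (μ : PMF Λ) (S : G.Strategy ρ Λ) (q : G.Question) :
    prob μ S q {r | G.accept q r} + prob μ S q {r | ¬ G.accept q r} = 1 := by
  classical
  rw [prob_eq, prob_eq, ← ENNReal.tsum_add]
  simp only [← mul_add, ← ENNReal.tsum_add]
  rw [← μ.tsum_coe]
  refine tsum_congr fun l => ?_
  rw [show (∑' x, weight (tree S l q) x * _) = 1 from ?_, mul_one]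
  rw [← tsum_weight (tree S l q)]
  refine tsum_congr fun x => ?_
  by_cases h : G.accept q (responses S l q x) <;> simp [h]

lemma winProb_add_loseProb (μ : PMF Λ) (S : G.Strategy ρ Λ) (q : G.Question) :
    winProb μ S q + loseProb μ S q = 1 := by
  have h := prob_win_add_lose μ S q
  unfold winProb loseProb
  rw [← ENNReal.toReal_add, h, ENNReal.toReal_one]
  · exact ne_top_of_le_ne_top ENNReal.one_ne_top (h ▸ le_self_add)
  · exact ne_top_of_le_ne_top ENNReal.one_ne_top (h ▸ le_add_self)

/-- The verdict reads only the outputs of players on whom it depends, and their law is unaffected by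
the queries of the rest. So loss probabilities may be computed with any programs for the remaining
players. -/
lemma tsum_weight_mul_loss {S : G.Strategy ρ Λ} {l : Λ} {q : G.Question} {τ : Trees ρ}
    (hτ : ∀ p, G.DependsOn q p → τ p = tree S l q p) :
    ∑' x, weight τ x * loss S l q x = loseAt S l q := by
  refine tsum_weight_congr {p | G.DependsOn q p} hτ _ fun x x' h => indicator_congr fun p hp => ?_
  exact responses_congr (fun i => h i p hp) fun _ _ => rfl

lemma loseAt_congr {S S' : G.Strategy ρ Λ} {l : Λ} {q : G.Question}
    (hS : ∀ p, G.DependsOn q p → ∀ z, q p = some z → S l p z = S' l p z) :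
    loseAt S l q = loseAt S' l q := by
  rw [← tsum_weight_mul_loss (τ := tree S' l q) (S := S) fun p hp =>
    (tree_congr rfl (hS p hp)).symm]
  refine tsum_congr fun x => ?_
  congr 1
  exact indicator_congr fun p hp => responses_congr (fun _ => rfl) (hS p hp)

/-- A player whose partners are no parties of the resource `R` can avoid it on one question. -/
lemma exists_ignores_loseAt_le (S : G.Strategy ρ Λ) (l : Λ) {v : P} {R : ι} {Q : G.Question}
    {z : G.In v} (hz : Q v = some z)
    (hQR : ∀ u, u ≠ v → G.DependsOn Q u → ¬ (ρ R).Involves u) :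
    ∃ t : ResourceProgram (fun i => (ρ i).In v) (fun i => (ρ i).Out v)
      (fun i => (ρ i).rounds v) (G.Out v) 0, t.Ignores R ∧
      ∀ S' : G.Strategy ρ Λ, (∀ p, p ≠ v → S' l p = S l p) → S' l v z = t →
        loseAt S' l Q ≤ loseAt S l Q := by
  classical
  have hv : (Q v).isSome := by simp [hz]
  have hget : (Q v).get hv = z := by simp [hz]
  -- Irrelevant players are silenced. They might be parties of `R`, and then their queries could
  -- correlate with `v`'s end.
  let τ : Trees ρ := fun p => if G.DependsOn Q p then tree S l Q p else .answer ()
  let F : Outputs ρ → G.Out v → ℝ≥0∞ := fun x y =>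
    {r | ¬ G.accept Q r}.indicator 1 (Function.update (responses S l Q x) ⟨v, hv⟩ y)
  have hrounds : ∀ p, p ≠ v → G.DependsOn Q p → IsEmpty (Fin ((ρ R).rounds p)) := by
    intro p hp hd
    have := Nat.eq_zero_of_not_pos (hQR p hp hd)
    rw [this]
    infer_instance
  have hupd : ∀ p, p ≠ v → G.DependsOn Q p → ∀ (x : Outputs ρ) w i,
      Function.update x R w i p = x i p := by
    intro p hp hd x w i
    have := hrounds p hp hd
    by_cases hi : i = R
    · subst hi
      exact Subsingleton.elim _ _
    · simp [hi]
  have key : ∀ S' : G.Strategy ρ Λ, (∀ p, p ≠ v → S' l p = S l p) →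
      ∑' x, weight (Function.update τ v (S' l v z).forget) x *
        F x ((S' l v z).response fun i => x i v) = loseAt S' l Q := by
    intro S' hS'
    rw [← tsum_weight_mul_loss (τ := Function.update τ v (S' l v z).forget)]
    · refine tsum_congr fun x => ?_
      congr 1
      refine indicator_congr fun p _ => ?_
      by_cases hp : p = ⟨v, hv⟩
      · subst hp
        simp only [Function.update_self, responses, hget]
      · rw [Function.update_of_ne hp]
        have hpv : p.1 ≠ v := fun e => hp (Subtype.ext e)
        exact responses_congr (fun _ => rfl) fun _ _ => by rw [hS' p hpv]
    · intro p hd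
      by_cases hp : p = v
      · subst hp
        simp [tree, hz]
      · simp only [Function.update_of_ne hp, τ, if_pos hd]
        exact tree_congr rfl fun _ _ => by rw [hS' p hp]
  obtain ⟨t, ht, hle⟩ := exists_ignores_tsum_le (v := v) (R := R) (F := F) τ
    (fun p hp x w i => by
      by_cases hd : G.DependsOn Q p
      · simp only [treeInputs, hupd p hp hd]
      · simp [treeInputs, τ, hd, ResourceProgram.inputs])
    (fun p hp x x' => by
      by_cases hd : G.DependsOn Q p
      · have := hrounds p hp hd
        exact Subsingleton.elim _ _
      · simp [treeInputs, τ, hd, ResourceProgram.inputs])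
    (fun x w => by
      funext y
      refine indicator_congr fun p hd => ?_
      by_cases hp : p = ⟨v, hv⟩
      · subst hp
        simp
      · rw [Function.update_of_ne hp, Function.update_of_ne hp]
        exact responses_congr (hupd p (fun e => hp (Subtype.ext e)) hd x w) fun _ _ => rfl)
    (S l v z)
  refine ⟨t, ht, fun S' hS' hS'v => ?_⟩
  rw [← key S fun _ _ => rfl, ← key S' hS', hS'v]
  exact hle

/-- The loss caused by changing the behaviour of `v` on an input for which it has to match the
responses of players that answer in the same way on question `q`. -/
lemma loseAt_le_add (hG : G.IsUnique) {S S' : G.Strategy ρ Λ} {l : Λ} {v : P}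
    (hS : ∀ p, p ≠ v → S' l p = S l p) {Q : G.Question} (hQ : Q ∈ G.questions)
    (hQv : G.DependsOn Q v) {q : G.Question} (hqv : q v = Q v)
    (hcompat : ∀ u, u ≠ v → G.DependsOn Q u → q u = Q u ∨ ¬ G.DependsOn q u) :
    loseAt S' l q ≤ loseAt S l q + (loseAt S l Q + loseAt S' l Q) := by
  classical
  by_cases hd : G.DependsOn q v
  swap
  · refine (loseAt_congr fun p hp z _ => ?_).trans_le le_self_add
    rw [hS p fun e => hd (e ▸ hp)]
  have hv : (Q v).isSome := hQv.isSome
  have hv' : (q v).isSome := hd.isSome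
  -- The unique response of `v` that wins `Q`. By `hcc` it depends only on the responses of the
  -- other relevant players.
  let c : G.Responses Q → G.Out v := fun r => (hG Q hQ ⟨v, hv⟩ hQv r).choose
  have hc : ∀ r, G.accept Q (Function.update r ⟨v, hv⟩ (c r)) := fun r =>
    (hG Q hQ ⟨v, hv⟩ hQv r).choose_spec.1
  have hc' : ∀ r y, G.accept Q (Function.update r ⟨v, hv⟩ y) → y = c r := fun r =>
    (hG Q hQ ⟨v, hv⟩ hQv r).choose_spec.2
  have hcc : ∀ r r' : G.Responses Q, (∀ p : {p // (Q p).isSome},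
      p.1 ≠ v → G.DependsOn Q p → r p = r' p) → c r = c r' := by
    intro r r' h
    refine hc' r' _ ((accept_congr fun p hp => ?_).1 (hc r))
    by_cases hpv : p = ⟨v, hv⟩
    · subst hpv; simp
    · rw [Function.update_of_ne hpv, Function.update_of_ne hpv,
        h p (fun e => hpv (Subtype.ext e)) hp]
  -- The common probability space. This tuple need not be asked by the verifier: only its programs
  -- matter, while verdicts are taken for `q` and for `Q`.
  let q' : G.Question := fun p => if G.DependsOn Q p then Q p else q p
  have hq'v : q' v = q v := by simp [q', hQv, hqv]
  have hq'Q : ∀ p, G.DependsOn Q p → q' p = Q p := fun p hp => by simp [q', hp]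
  have hq'q : ∀ p, G.DependsOn q p → q' p = q p := by
    intro p hp
    by_cases hpv : p = v
    · exact hpv ▸ hq'v
    by_cases hpQ : G.DependsOn Q p
    · rw [hq'Q p hpQ]
      exact ((hcompat p hpv hpQ).resolve_right (not_not.2 hp)).symm
    · simp [q', hpQ]
  -- Loss on `q` if `v`'s response is replaced by the one that would win `Q`.
  let g : G.Strategy ρ Λ → Outputs ρ → ℝ≥0∞ := fun T x => {r | ¬ G.accept q r}.indicator 1
    (Function.update (responses T l q x) ⟨v, hv'⟩ (c (responses T l Q x)))
  have hget : ∀ (T : G.Strategy ρ Λ) x, G.accept Q (responses T l Q x) →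
      responses T l q x ⟨v, hv'⟩ = c (responses T l Q x) := by
    intro T x h
    have h1 : responses T l Q x ⟨v, hv⟩ = c (responses T l Q x) :=
      hc' _ _ (by rwa [Function.update_eq_self])
    rw [← h1]
    simp only [responses, hqv]
  have hupd : ∀ (T : G.Strategy ρ Λ) x, G.accept Q (responses T l Q x) →
      g T x = loss T l q x := by
    intro T x h
    simp only [g, loss, ← hget T x h, Function.update_eq_self]
  have hQ1 : ∀ (T : G.Strategy ρ Λ) x, ¬ G.accept Q (responses T l Q x) → loss T l Q x = 1 :=
    fun T x h => by simp [loss, h]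
  have hle1 : ∀ {q : G.Question} (r : G.Responses q),
      ({r | ¬ G.accept q r}.indicator 1 r : ℝ≥0∞) ≤ 1 :=
    fun r => Set.indicator_le' (fun _ _ => le_rfl) (fun _ _ => zero_le_one) r
  have hg_le : ∀ (T : G.Strategy ρ Λ) x, g T x ≤ loss T l q x + loss T l Q x := by
    intro T x
    by_cases h : G.accept Q (responses T l Q x)
    · exact (hupd T x h).le.trans le_self_add
    · exact (hle1 _).trans ((hQ1 T x h).ge.trans le_add_self)
  have hle_g : ∀ (T : G.Strategy ρ Λ) x, loss T l q x ≤ g T x + loss T l Q x := by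
    intro T x
    by_cases h : G.accept Q (responses T l Q x)
    · exact (hupd T x h).ge.trans le_self_add
    · exact (hle1 _).trans ((hQ1 T x h).ge.trans le_add_self)
  have hgS : ∀ x, g S' x = g S x := by
    intro x
    refine indicator_congr fun p _ => ?_
    by_cases hp : p = ⟨v, hv'⟩
    · subst hp
      simp only [Function.update_self]
      exact hcc _ _ fun u hu _ => responses_congr (fun _ => rfl) fun _ _ => by rw [hS u hu]
    · rw [Function.update_of_ne hp, Function.update_of_ne hp]
      exact responses_congr (fun _ => rfl) fun _ _ => by
        rw [hS p fun e => hp (Subtype.ext e)]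
  -- The corrected loss reads no output of `v`, so changing `v`'s program does not change its
  -- expectation.
  have hg_eq : ∑' x, weight (tree S' l q') x * g S x = ∑' x, weight (tree S l q') x * g S x := by
    refine tsum_weight_congr_of_ne (ρ := ρ) v
      (fun p hp => tree_congr rfl fun y _ => congrFun (hS p hp) y) (g S)
      fun x x' h => ?_
    refine indicator_congr fun p _ => ?_
    by_cases hp : p = ⟨v, hv'⟩
    · subst hp
      simp only [Function.update_self]
      exact hcc _ _ fun u hu _ => responses_congr (fun i => h i u hu) fun _ _ => rfl
    · rw [Function.update_of_ne hp, Function.update_of_ne hp]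
      exact responses_congr (fun i => h i p fun e => hp (Subtype.ext e)) fun _ _ => rfl
  have hloss : ∀ T : G.Strategy ρ Λ,
      ∑' x, weight (tree T l q') x * loss T l q x = loseAt T l q := fun T =>
    tsum_weight_mul_loss fun p hp => tree_congr (hq'q p hp) fun _ _ => rfl
  have hlossQ : ∀ T : G.Strategy ρ Λ,
      ∑' x, weight (tree T l q') x * loss T l Q x = loseAt T l Q := fun T =>
    tsum_weight_mul_loss fun p hp => tree_congr (hq'Q p hp) fun _ _ => rfl
  calc loseAt S' l q = ∑' x, weight (tree S' l q') x * loss S' l q x := (hloss S').symm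
    _ ≤ ∑' x, weight (tree S' l q') x * (g S x + loss S' l Q x) := by
        refine ENNReal.tsum_le_tsum fun x => ?_
        gcongr
        exact (hle_g S' x).trans_eq (by rw [hgS])
    _ = ∑' x, weight (tree S l q') x * g S x + loseAt S' l Q := by
        simp only [mul_add]
        rw [ENNReal.tsum_add, hg_eq, hlossQ]
    _ ≤ ∑' x, weight (tree S l q') x * (loss S l q x + loss S l Q x) + loseAt S' l Q := by
        gcongr
        exact hg_le S _
    _ = loseAt S l q + (loseAt S l Q + loseAt S' l Q) := by
        simp only [mul_add]
        rw [ENNReal.tsum_add, hloss, hlossQ, add_assoc]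

end NonlocalGame

/-! ### Assembly of the new strategy -/

theorem lemmat {P : Type*} [Fintype P] [DecidableEq P] (G : NonlocalGame P) (hG : G.IsUnique)
    {ι : Type*} [Fintype ι] [DecidableEq ι] (ρ : ι → NonSignalingResource P)
    {Λ : Type*} (μ : PMF Λ) (S : G.Strategy ρ Λ) (ε : ℝ)
    (hS : ∀ q ∈ G.questions, 1 - ε ≤ NonlocalGame.winProb μ S q)
    (v : P) (R : ι) (hRv : (ρ R).Involves v)
    (Q : G.Question) (hQ : Q ∈ G.questions) (z : G.In v) (hz : Q v = some z)
    (hQv : G.DependsOn Q v)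
    (hQR : ∀ u, u ≠ v → G.DependsOn Q u → ¬ (ρ R).Involves u)
    (hcompat : ∀ Q' ∈ G.questions, Q' ≠ Q → Q' v = Q v →
      ∀ u, u ≠ v → G.DependsOn Q u → Q' u = Q u ∨ ¬ G.DependsOn Q' u) :
    ∃ S' : G.Strategy ρ Λ,
      (∀ l p, p ≠ v → S' l p = S l p) ∧
      (∀ l y, y ≠ z → S' l v y = S l v y) ∧
      (∀ l, (S' l v z).Ignores R) ∧
      (∀ Q' ∈ G.questions, 1 - 3 * ε ≤ NonlocalGame.winProb μ S' Q') ∧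
      NonlocalGame.loseProb μ S' Q ≤ NonlocalGame.loseProb μ S Q ∧
      (∀ Q' ∈ G.questions, Q' v = Q v →
        NonlocalGame.loseProb μ S' Q' ≤
          NonlocalGame.loseProb μ S Q' + 2 * NonlocalGame.loseProb μ S Q) := by
  classical
  -- The outputs substituted for `R` are chosen separately for each value of the shared randomness.
  choose t ht hle using fun l => NonlocalGame.exists_ignores_loseAt_le S l hz hQR
  let S' : G.Strategy ρ Λ := fun l => Function.update (S l) v (Function.update (S l v) z (t l))
  have hS'p : ∀ l p, p ≠ v → S' l p = S l p := fun l p hp => by simp [S', hp]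
  have hS'y : ∀ l y, y ≠ z → S' l v y = S l v y := fun l y hy => by simp [S', hy]
  have hS'z : ∀ l, S' l v z = t l := fun l => by simp [S']
  have hQle : ∀ l, NonlocalGame.loseAt S' l Q ≤ NonlocalGame.loseAt S l Q := fun l =>
    hle l S' (hS'p l) (hS'z l)
  have hfin : ∀ (T : G.Strategy ρ Λ) q, NonlocalGame.prob μ T q {r | ¬ G.accept q r} ≠ ∞ :=
    fun T q => ne_top_of_le_ne_top ENNReal.one_ne_top
      (NonlocalGame.prob_win_add_lose μ T q ▸ le_add_self)
  have hloseQ : NonlocalGame.loseProb μ S' Q ≤ NonlocalGame.loseProb μ S Q := by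
    refine ENNReal.toReal_mono (hfin S Q) ?_
    rw [NonlocalGame.prob_lose_eq, NonlocalGame.prob_lose_eq]
    gcongr
    exact hQle _
  have hlose0 : ∀ q, 0 ≤ NonlocalGame.loseProb μ S q := fun q => ENNReal.toReal_nonneg
  have hloseQ' : ∀ Q' ∈ G.questions, Q' v = Q v → NonlocalGame.loseProb μ S' Q' ≤
      NonlocalGame.loseProb μ S Q' + 2 * NonlocalGame.loseProb μ S Q := by
    intro Q' hQ' hv
    by_cases hne : Q' = Q
    · subst hne
      linarith [hlose0 Q']
    have h : NonlocalGame.prob μ S' Q' {r | ¬ G.accept Q' r} ≤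
        NonlocalGame.prob μ S Q' {r | ¬ G.accept Q' r} +
          2 * NonlocalGame.prob μ S Q {r | ¬ G.accept Q r} := by
      simp only [NonlocalGame.prob_lose_eq]
      rw [← ENNReal.tsum_mul_left, ← ENNReal.tsum_add]
      refine ENNReal.tsum_le_tsum fun l => ?_
      rw [mul_left_comm, ← mul_add]
      gcongr
      refine (NonlocalGame.loseAt_le_add hG (hS'p l) hQ hQv hv
        (hcompat Q' hQ' hne hv)).trans ?_
      rw [two_mul]
      gcongr
      exact hQle l
    have h' := ENNReal.toReal_mono (ENNReal.add_ne_top.2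
      ⟨hfin S Q', ENNReal.mul_ne_top ENNReal.ofNat_ne_top (hfin S Q)⟩) h
    rwa [ENNReal.toReal_add (hfin S Q') (ENNReal.mul_ne_top ENNReal.ofNat_ne_top (hfin S Q)),
      ENNReal.toReal_mul, ENNReal.toReal_ofNat] at h'
  have hloseS : ∀ q ∈ G.questions, NonlocalGame.loseProb μ S q ≤ ε := fun q hq => by
    linarith [hS q hq, NonlocalGame.winProb_add_loseProb μ S q]
  refine ⟨S', hS'p, hS'y, fun l => (hS'z l).symm ▸ ht l, fun Q' hQ' => ?_, hloseQ, hloseQ'⟩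
  have hwin := NonlocalGame.winProb_add_loseProb μ S' Q'
  have hQε := hloseS Q hQ
  have hQ'ε := hloseS Q' hQ'
  by_cases hv : Q' v = Q v
  -- The new loss is at most `ε + 2 * ε`.
  · linarith [hloseQ' Q' hQ' hv]
  · have heq : NonlocalGame.loseProb μ S' Q' = NonlocalGame.loseProb μ S Q' := by
      unfold NonlocalGame.loseProb
      rw [NonlocalGame.prob_lose_eq, NonlocalGame.prob_lose_eq]
      congr 1
      refine tsum_congr fun l => ?_
      congr 1
      refine NonlocalGame.loseAt_congr fun p _ y hy => ?_
      by_cases hp : p = v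
      · subst hp
        exact hS'y l y fun e => hv (by rw [hy, e, hz])
      · rw [hS'p l p hp]
    -- The loss is unchanged, hence at most `ε`; nonnegativity of the loss on `Q` gives `0 ≤ ε`, so
    -- `ε ≤ 3 * ε`.
    linarith [hlose0 Q]
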